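/- Lemma 3.1. Let $(W,S)$ be a Coxeter system ($S$ possibly infinite) with Coxeter matrix $(m_{s,t})_{s,t\in S}$. Let $M$ be the associated Artin–Tits monoid, that is, the monoid generated by $S$ subject to the relations $sts\cdots = tst\cdots$ (both sides alternating words with $m_{s,t}$ letters) for all $s\neq t$ in $S$ with $m_{s,t}<\infty$, and let $\pi\colon M\to W$ be the canonical projection. A word in $S$ is *reduced* if it has minimal length among the words that represent the same element of $W$. For $w\in W$, let $\sigma(w)\in M$ be the element of $M$ represented by a reduced word for $w$; it does not depend on the choice of the reduced word. Put $\underline{W}=\sigma(W)\subseteq M$. For $f,g\in M$, say that $f$ *left-divides* $g$, written $f\preceq g$, if $g=fh$ for some $h\in M$, and that $f$ *right-divides* $g$ if $g=hf$ for some $h\in M$. A *right-lcm* of $f$ and $g$ is an element $h$ with $f\preceq h$ and $g\preceq h$ such that $h\preceq k$ for every $k$ with $f\preceq k$ and $g\preceq k$. A *Garside family* of a left-cancellative monoid $M$ with no nontrivial invertible element is a subset $F\subseteq M$ with $1\in F$ such that every $g\in M$ can be written $g=s_1\cdots s_p$ with all $s_i\in F$ and such that, for every $i<p$, every $s\in F$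 and every $f\in M$, $s\preceq f s_i s_{i+1}$ implies $s\preceq f s_i$. The (right) weak order on $W$ is defined by: $u\le w$ if and only if some reduced word for $u$ is a prefix of some reduced word for $w$. The join $u\vee v$ is the least upper bound of $u$ and $v$ for $\le$, when it exists. Then: (i) The monoid $M$ is left-cancellative with no nontrivial invertible element, and $\underline{W}$ is a Garside family of $M$. (ii) For all $f,g\in\underline{W}$, $f$ left-divides $g$ in $M$ if and only if $\pi(f)\le\pi(g)$ in $W$; and $f$ right-divides $g$ in $M$ if and only if some reduced word for $\pi(f)$ is a suffix of some reduced word for $\pi(g)$. (iii) For all $f,g\in\underline{W}$, $f$ and $g$ have a right-lcm in $M$ if and only if $\pi(f)\vee\pi(g)$ exists in $W$. In this case, the right-lcm of $f$ and $g$ lies in $\underline{W}$ and is equal to $\sigma(\pi(f)\vee\pi(g))$. -/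

import Mathlib

namespace ArtinTits

/-! ### Monoids: divisibility, right-lcms, Garside families

In a (noncommutative) monoid, Mathlib's `f ∣ g` unfolds to `∃ h, g = f * h`, so it is
left-divisibility: `f ∣ g` means that `f` left-divides `g`, i.e. `g` is a right-multiple of `f`. -/

/-- `f` right-divides `g`. -/
def RightDivides {N : Type*} [Monoid N] (f g : N) : Prop :=
  ∃ h : N, g = h * f

/-- `h` is a right-lcm (least common right-multiple) of `f` and `g`. -/
def IsRightLcm {N : Type*} [Monoid N] (f g h : N) : Prop :=
  f ∣ h ∧ g ∣ h ∧ ∀ k : N, f ∣ k → g ∣ k → h ∣ k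

/-- `(a, b)` is `F`-greedy: every `s ∈ F` that left-divides some `f a b` left-divides `f a`. -/
def IsGreedyPair {N : Type*} [Monoid N] (F : Set N) (a b : N) : Prop :=
  ∀ s ∈ F, ∀ f : N, s ∣ f * a * b → s ∣ f * a

/-- The finite sequence `l` is an `F`-normal decomposition of `g`. -/
def IsNormalDecomposition {N : Type*} [Monoid N] (F : Set N) (l : List N) (g : N) : Prop :=
  l.prod = g ∧ (∀ s ∈ l, s ∈ F) ∧ l.IsChain (IsGreedyPair F)

/-- `F` is a Garside family of the monoid `N`. The notion makes sense only in a left-cancellative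
monoid with no nontrivial invertible element; these two requirements are part of the predicate. -/
structure IsGarsideFamily {N : Type*} [Monoid N] (F : Set N) : Prop where
  left_cancel : ∀ f g h : N, f * g = f * h → g = h
  no_units : ∀ f g : N, f * g = 1 → f = 1 ∧ g = 1
  one_mem : (1 : N) ∈ F
  exists_normal : ∀ g : N, ∃ l : List N, IsNormalDecomposition F l g

/-! ### Artin–Tits monoids -/

/-- The braid relations `sts⋯ = tst⋯`, with `m_{s,t}` alternating letters on each side, for all
`s, t` with `m_{s,t}` finite (Mathlib encodes `m_{s,t} = ∞` as `M s t = 0`). -/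
def braidRel {B : Type*} (M : CoxeterMatrix B) (u v : FreeMonoid B) : Prop :=
  ∃ s t : B, M s t ≠ 0 ∧
    u = FreeMonoid.ofList (CoxeterSystem.braidWord M s t) ∧
    v = FreeMonoid.ofList (CoxeterSystem.braidWord M t s)

/-- The Artin–Tits monoid associated with a Coxeter matrix. -/
abbrev ArtinMonoid {B : Type*} (M : CoxeterMatrix B) : Type _ :=
  PresentedMonoid (braidRel M)

/-- The element of the Artin–Tits monoid represented by a word in the generators. -/
def ofWord {B : Type*} (M : CoxeterMatrix B) (ω : List B) : ArtinMonoid M :=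
  PresentedMonoid.mk (braidRel M) (FreeMonoid.ofList ω)

/-! ### The projection to the Coxeter group and its section -/

theorem lift_simple_eq_of_braidRel {B W : Type*} [Group W] {M : CoxeterMatrix B}
    (cs : CoxeterSystem M W) (u v : FreeMonoid B) (h : braidRel M u v) :
    FreeMonoid.lift cs.simple u = FreeMonoid.lift cs.simple v := by
  obtain ⟨s, t, -, rfl, rfl⟩ := h
  rw [FreeMonoid.lift_ofList, FreeMonoid.lift_ofList]
  exact cs.wordProd_braidWord_eq s t

/-- The canonical projection `π` from the Artin–Tits monoid to the Coxeter group. -/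
def proj {B W : Type*} [Group W] {M : CoxeterMatrix B} (cs : CoxeterSystem M W) :
    ArtinMonoid M →* W :=
  PresentedMonoid.lift cs.simple (lift_simple_eq_of_braidRel cs)

/-- The section `σ` of `π`: it maps `w` to the element of the monoid represented by a reduced word
for `w`. (A reduced word is chosen; the result does not depend on it, by Matsumoto's lemma.) -/
noncomputable def lift {B W : Type*} [Group W] {M : CoxeterMatrix B} (cs : CoxeterSystem M W)
    (w : W) : ArtinMonoid M :=
  ofWord M (cs.exists_isReduced w).choose

/-- The copy of `W` inside the Artin–Tits monoid: the image of the section. -/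
def copy {B W : Type*} [Group W] {M : CoxeterMatrix B} (cs : CoxeterSystem M W) :
    Set (ArtinMonoid M) :=
  Set.range (lift cs)

/-! ### The weak order and suffixes in the Coxeter group -/

/-- `ω` is a reduced word for `w`. -/
def IsReducedWordFor {B W : Type*} [Group W] {M : CoxeterMatrix B} (cs : CoxeterSystem M W)
    (ω : List B) (w : W) : Prop :=
  cs.IsReduced ω ∧ cs.wordProd ω = w

/-- The (right) weak order: a reduced word for `u` is a prefix of a reduced word for `w`. -/
def WeakLE {B W : Type*} [Group W] {M : CoxeterMatrix B} (cs : CoxeterSystem M W)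
    (u w : W) : Prop :=
  ∃ ω ω' : List B, IsReducedWordFor cs ω u ∧ IsReducedWordFor cs ω' w ∧ ω <+: ω'

/-- A reduced word for `u` is a suffix of a reduced word for `w`. -/
def IsReducedSuffix {B W : Type*} [Group W] {M : CoxeterMatrix B} (cs : CoxeterSystem M W)
    (u w : W) : Prop :=
  ∃ ω ω' : List B, IsReducedWordFor cs ω u ∧ IsReducedWordFor cs ω' w ∧ ω <:+ ω'

/-- `w` is the join of `u` and `v`: their least upper bound in the right weak order. -/
def IsWeakJoin {B W : Type*} [Group W] {M : CoxeterMatrix B} (cs : CoxeterSystem M W)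
    (u v w : W) : Prop :=
  WeakLE cs u w ∧ WeakLE cs v w ∧ ∀ x : W, WeakLE cs u x → WeakLE cs v x → WeakLE cs w x

end ArtinTits

namespace ArtinTits

/-! ### The geometric representation of a Coxeter group -/

/-! ### Chebyshev polynomials at `2 cos φ`. -/

section Chebyshev

open Polynomial.Chebyshev Polynomial

/-! The heart of the matter is that every `g` in the monoid has a head: a greatest `w` in `W` with
`lift cs w ∣ g` (`lift_dvd_iff`). For `u`, `w` in `W`, the prefixes `x` of `w` such that lengths add
in `u x` have a greatest element, and `u` acts on pairs by sending `(w, h)` to `(u x, lift cs (x⁻¹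
w) * h)`. By `mul_greatestPrefix_mul` this respects length-additive products, hence the braid
relations, so the whole monoid acts. The action of `g` multiplies the value `lift cs w * h` on the
left by `g`; applied to `(1, 1)` it splits `g` into head and tail.

The rest follows. A generator's action loses no information, which gives left cancellation. The head
of `f g` depends only on `f` and the head of `g` (`head_mul`), which gives greediness. The head of a
common right-multiple of elements of the copy of `W` is again such a multiple, so right-lcms are
joins. Matsumoto's lemma and the additive length `len` identify divisibility inside the copy with
length-additive factorization in `W`.

The greatest prefix comes from a diamond argument: two covers `x s`, `x t` are bounded by `x` times
the longest element of the parabolic subgroup of `s` and `t`. This needs lengths to add on minimal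
coset representatives of rank two, which rests on the geometric representation: `w` sends the simple
root at `i` to a nonnegative vector exactly when `i` is not a right descent of `w`. -/

theorem eval_S_two_mul_cos_mul_sin (φ : ℝ) (n : ℤ) :
    (S ℝ n).eval (2 * Real.cos φ) * Real.sin φ = Real.sin ((n + 1) * φ) := by
  induction n using Polynomial.Chebyshev.induct with
  | zero => simp
  | one =>
    have : ((1 : ℤ) + 1 : ℝ) * φ = 2 * φ := by push_cast; ring
    simp only [S_one, eval_X, this, Real.sin_two_mul]; ring
  | add_two n ih1 ih0 =>
    rw [S_add_two]
    simp only [eval_sub, eval_mul, eval_X, sub_mul, mul_assoc, ih0]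
    rw [ih1]
    push_cast
    have h := Real.sin_add (((n : ℝ) + 1 + 1) * φ) φ
    have h' := Real.sin_sub (((n : ℝ) + 1 + 1) * φ) φ
    rw [show ((n : ℝ) + 1 + 1) * φ + φ = (n + 2 + 1) * φ by ring] at h
    rw [show ((n : ℝ) + 1 + 1) * φ - φ = (n + 1) * φ by ring] at h'
    rw [h, h']; ring
  | neg_add_one n ih1 ih0 =>
    rw [S_sub_one]
    simp only [eval_sub, eval_mul, eval_X, sub_mul, mul_assoc, ih0]
    rw [ih1]
    push_cast
    have h := Real.sin_add ((-(n : ℝ) + 1) * φ) φ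
    have h' := Real.sin_sub ((-(n : ℝ) + 1) * φ) φ
    rw [show (-(n : ℝ) + 1) * φ + φ = (-n + 1 + 1) * φ by ring] at h
    rw [show (-(n : ℝ) + 1) * φ - φ = (-n - 1 + 1) * φ by ring] at h'
    rw [h, h']; ring

/-- For finite `m` the value is `sin ((k+1)π/m) / sin (π/m)`, with the angle `(k+1)π/m` in `[0, π]`.
For `m = 0`, which encodes `∞`, the argument is `2` and the value is `k + 1`. -/
theorem eval_S_two_mul_cos_nonneg {m : ℕ} (hm : m ≠ 1) {k : ℤ} (hk : -1 ≤ k)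
    (hkm : m ≠ 0 → k < m) : 0 ≤ (S ℝ k).eval (2 * Real.cos (Real.pi / m)) := by
  rcases Nat.eq_zero_or_pos m with rfl | hpos
  · have : (-1 : ℝ) ≤ k := by exact_mod_cast hk
    simp only [Nat.cast_zero, div_zero, Real.cos_zero, mul_one, S_eval_two]
    linarith
  · have hm2 : (2 : ℝ) ≤ m := by exact_mod_cast (by lia : 2 ≤ m)
    have hs : 0 < Real.sin (Real.pi / m) := by
      apply Real.sin_pos_of_pos_of_lt_pi
      · positivity
      · rw [div_lt_iff₀ (by linarith)]
        nlinarith [Real.pi_pos]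
    refine nonneg_of_mul_nonneg_left ?_ hs
    rw [eval_S_two_mul_cos_mul_sin]
    have h1 : (0 : ℝ) ≤ k + 1 := by exact_mod_cast (by lia : 0 ≤ k + 1)
    have h2 : (k : ℝ) + 1 ≤ m := by exact_mod_cast (hkm (by lia))
    apply Real.sin_nonneg_of_nonneg_of_le_pi
    · positivity
    · rw [← mul_div_assoc, div_le_iff₀ (by linarith), mul_comm]
      exact mul_le_mul_of_nonneg_left h2 Real.pi_pos.le

end Chebyshev

/-! ### Reflections, their braid relations, and positivity in rank two. -/

section Representation

variable {B : Type*} (M : CoxeterMatrix B)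

/-- The simple coroot at `i`: twice the canonical bilinear form paired with the simple root. -/
noncomputable def coroot (i : B) : Module.Dual ℝ (B →₀ ℝ) :=
  -- One formula covers all cases: on the diagonal `M i i = 1` gives `2`, and for `m = ∞`, encoded
  -- as `0`, the convention `π / 0 = 0` gives the usual value `-2`.
  Finsupp.linearCombination ℝ (fun j ↦ -2 * Real.cos (Real.pi / M i j))

@[simp]
theorem coroot_single (i j : B) :
    coroot M i (Finsupp.single j 1) = -2 * Real.cos (Real.pi / M i j) := by
  simp [coroot]

theorem coroot_single_self (i : B) : coroot M i (Finsupp.single i 1) = 2 := by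
  simp

/-- The reflection of the geometric representation attached to a generator. -/
noncomputable def simpleReflection (i : B) : (B →₀ ℝ) ≃ₗ[ℝ] (B →₀ ℝ) :=
  Module.reflection (coroot_single_self M i)

theorem simpleReflection_apply (i : B) (v : B →₀ ℝ) :
    simpleReflection M i v = v - coroot M i v • Finsupp.single i 1 :=
  Module.reflection_apply _ _

theorem simpleReflection_mul_self (i : B) : simpleReflection M i * simpleReflection M i = 1 := by
  ext1 v
  exact Module.involutive_reflection (coroot_single_self M i) v

-- Powers of a product of two reflections have Chebyshev coefficients at `2 cos φ`, where `φ = 2π/m`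
-- is the rotation angle; these vanish at the `m`-th power.
open Polynomial.Chebyshev in
theorem isLiftable_simpleReflection : M.IsLiftable (simpleReflection M) := by
  intro i j
  rcases eq_or_ne i j with rfl | hij
  · rw [M.diagonal, pow_one, simpleReflection_mul_self]
  have h1 := M.off_diagonal i j hij
  set m := M i j with hm
  have hji : M j i = m := M.symmetric j i
  rcases Nat.eq_zero_or_pos m with h0 | hpos
  · rw [h0, pow_zero]
  ext1 z
  -- Here `φ` would be `π`, so one could not divide by `sin φ`; the two reflections commute instead.
  by_cases h2 : m = 2
  · have hij0 : coroot M i (Finsupp.single j 1) = 0 := by simp [← hm, h2]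
    have hji0 : coroot M j (Finsupp.single i 1) = 0 := by simp [hji, h2]
    rw [h2, pow_two]
    simp only [LinearEquiv.mul_apply, simpleReflection_apply, map_sub, map_smul, hij0, hji0,
      coroot_single_self, LinearEquiv.coe_one, id_eq]
    module
  set φ : ℝ := 2 * (Real.pi / m) with hφ
  have hm3 : (3 : ℝ) ≤ m := by exact_mod_cast (by lia : 3 ≤ m)
  have hmφ : m * φ = 2 * Real.pi := by rw [hφ]; field_simp
  have hs : 0 < Real.sin φ := by
    apply Real.sin_pos_of_pos_of_lt_pi
    · positivity
    · nlinarith [Real.pi_pos]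
  have ht : 2 * Real.cos φ =
      coroot M i (Finsupp.single j 1) * coroot M j (Finsupp.single i 1) - 2 := by
    rw [coroot_single, coroot_single, hji, ← hm, hφ, Real.cos_two_mul]; ring
  have key := Module.reflection_mul_reflection_pow_apply (coroot_single_self M i)
    (coroot_single_self M j) m z (2 * Real.cos φ) ht
  refine key.trans ?_
  have hS := eval_S_two_mul_cos_mul_sin φ
  have zero_of {x : ℝ} (h : x * Real.sin φ = 0) : x = 0 :=
    (mul_eq_zero.1 h).resolve_right hs.ne'
  obtain ⟨k, hk | hk⟩ := Nat.even_or_odd' m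
  · have e1 : ((m : ℤ) - 2) / 2 = k - 1 := by lia
    have e2 : ((m : ℤ) - 1) / 2 = k - 1 := by lia
    -- For `m = 2k`, `kφ = π`.
    have h : (S ℝ (k - 1)).eval (2 * Real.cos φ) = 0 := by
      apply zero_of
      rw [hS]
      push_cast
      have : (m : ℝ) = 2 * k := by exact_mod_cast hk
      rw [show ((k : ℝ) - 1 + 1) * φ = Real.pi by rw [this] at hmφ; linarith, Real.sin_pi]
    rw [e1, e2, h]
    simp
  · have e1 : ((m : ℤ) - 2) / 2 = k - 1 := by lia
    have e2 : ((m : ℤ) - 1) / 2 = k := by lia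
    have e3 : ((m : ℤ) - 3) / 2 = k - 1 := by lia
    have e4 : (m : ℤ) / 2 = k := by lia
    -- For `m = 2k + 1`, the angles `(k+1)φ` and `kφ` add up to `2π`, so their sines cancel.
    have h : (S ℝ k).eval (2 * Real.cos φ) + (S ℝ (k - 1)).eval (2 * Real.cos φ) = 0 := by
      apply zero_of
      rw [add_mul, hS, hS]
      push_cast
      have : (m : ℝ) = 2 * k + 1 := by exact_mod_cast hk
      rw [show ((k : ℝ) + 1) * φ = 2 * Real.pi - ((k : ℝ) - 1 + 1) * φ by
        rw [this] at hmφ; linarith, Real.sin_two_pi_sub]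
      ring
    rw [e1, e2, e3, e4, h]
    simp

variable {M} {W : Type*} [Group W] (cs : CoxeterSystem M W)

/-- The geometric representation of a Coxeter group. -/
noncomputable def geomRep : W →* ((B →₀ ℝ) ≃ₗ[ℝ] (B →₀ ℝ)) :=
  cs.lift ⟨simpleReflection M, isLiftable_simpleReflection M⟩

@[simp]
theorem geomRep_simple (i : B) : geomRep cs (cs.simple i) = simpleReflection M i :=
  cs.lift_apply_simple _ i

theorem geomRep_mul_simple_self (w : W) (i : B) :
    geomRep cs (w * cs.simple i) (Finsupp.single i 1) = -geomRep cs w (Finsupp.single i 1) := by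
  rw [map_mul, LinearEquiv.mul_apply, geomRep_simple, simpleReflection,
    Module.reflection_apply_self, map_neg]

theorem geomRep_mul_simple (w : W) (i j : B) :
    geomRep cs (w * cs.simple j) (Finsupp.single i 1) =
      geomRep cs w (Finsupp.single i 1) +
        (2 * Real.cos (Real.pi / M i j)) • geomRep cs w (Finsupp.single j 1) := by
  rw [map_mul, LinearEquiv.mul_apply, geomRep_simple, simpleReflection_apply, coroot_single,
    M.symmetric j i, map_sub, map_smul]
  module

-- Peeling two letters from the right: the last letter `j` adds a multiple of the root at `j`, and
-- the `i` before it negates the root at `i`. This is the recurrence `S (k+2) = X * S (k+1) - S k`.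
open Polynomial.Chebyshev in
theorem geomRep_mul_alternatingWord (w : W) (i j : B) (k : ℕ) :
    geomRep cs (w * cs.wordProd (CoxeterSystem.alternatingWord i j k)) (Finsupp.single i 1) =
      (S ℝ k).eval (2 * Real.cos (Real.pi / M i j)) •
          geomRep cs w (Finsupp.single (if Even k then i else j) 1) +
        (S ℝ (k - 1)).eval (2 * Real.cos (Real.pi / M i j)) •
          geomRep cs w (Finsupp.single (if Even k then j else i) 1) := by
  induction k using Nat.twoStepInduction generalizing i j with
  | zero => simp [CoxeterSystem.alternatingWord]
  | one =>
    simp only [CoxeterSystem.alternatingWord, List.concat_eq_append, List.nil_append,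
      cs.wordProd_singleton, geomRep_mul_simple]
    simp [add_comm]
  | more k ih0 ih1 =>
    rw [CoxeterSystem.alternatingWord_succ, cs.wordProd_concat, ← mul_assoc, geomRep_mul_simple,
      ih1 j i, CoxeterSystem.alternatingWord_succ, cs.wordProd_concat, ← mul_assoc,
      geomRep_mul_simple_self, ih0 i j, M.symmetric j i]
    have e1 : ((k + 2 : ℕ) : ℤ) = k + 2 := by push_cast; ring
    have e2 : ((k + 1 : ℕ) : ℤ) = k + 1 := by push_cast; ring
    have e3 : (k : ℤ) + 2 - 1 = k + 1 := by ring
    have e4 : (k : ℤ) + 1 - 1 = k := by ring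
    rw [e1, e2, e3, e4, S_add_two, S_add_one]
    by_cases hk : Even k
    · have h1 : ¬ Even (k + 1) := by simpa [Nat.even_add_one] using hk
      have h2 : Even (k + 2) := by simpa [Nat.even_add] using hk
      simp only [hk, h1, h2, if_true, if_false, Polynomial.eval_sub, Polynomial.eval_mul,
        Polynomial.eval_X]
      module
    · have h1 : Even (k + 1) := by simpa [Nat.even_add_one] using hk
      have h2 : ¬ Even (k + 2) := by simpa [Nat.even_add] using hk
      simp only [hk, h1, h2, if_true, if_false, Polynomial.eval_sub, Polynomial.eval_mul,
        Polynomial.eval_X]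
      module

theorem geomRep_mul_alternatingWord_nonneg {w : W} {i j : B} (hij : i ≠ j)
    (hi : 0 ≤ geomRep cs w (Finsupp.single i 1)) (hj : 0 ≤ geomRep cs w (Finsupp.single j 1))
    {k : ℕ} (hk : M i j ≠ 0 → k < M i j) :
    0 ≤ geomRep cs (w * cs.wordProd (CoxeterSystem.alternatingWord i j k))
      (Finsupp.single i 1) := by
  rw [geomRep_mul_alternatingWord]
  have h1 := M.off_diagonal i j hij
  refine add_nonneg (smul_nonneg (eval_S_two_mul_cos_nonneg h1 (by lia) (by lia)) ?_)
    (smul_nonneg (eval_S_two_mul_cos_nonneg h1 (by lia) (by lia)) ?_)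
  · split_ifs <;> assumption
  · split_ifs <;> assumption

end Representation

/-! ### Descents and rank two cosets -/

section Descents

open CoxeterSystem (alternatingWord braidWord)

variable {B W : Type*} [Group W] {M : CoxeterMatrix B} (cs : CoxeterSystem M W)

/-- An element without right descent at `i` is an element without right descents at `i` and `j`
times an alternating word in `i` and `j`, with additive lengths. -/
theorem exists_eq_mul_alternatingWord (w : W) (i j : B) (hi : ¬ cs.IsRightDescent w i) :
    ∃ (p : W) (k : ℕ), ¬ cs.IsRightDescent p i ∧ ¬ cs.IsRightDescent p j ∧
      w = p * cs.wordProd (alternatingWord i j k) ∧ cs.length w = cs.length p + k := by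
  induction h : cs.length w generalizing w i j with
  | zero =>
    obtain rfl := cs.length_eq_zero_iff.1 h
    exact ⟨1, 0, cs.not_isRightDescent_one i, cs.not_isRightDescent_one j, by
      simp [alternatingWord], by simp⟩
  | succ n ih =>
    by_cases hj : cs.IsRightDescent w j
    · have hlen := cs.isRightDescent_iff.1 hj
      -- After removing `j`, the shorter element has no descent at `j`, so the roles of `i` and `j`
      -- swap.
      obtain ⟨p, k, hpj, hpi, hw, hk⟩ := ih (w * cs.simple j) j i
        (cs.isRightDescent_iff_not_isRightDescent_mul.1 hj) (by lia)
      refine ⟨p, k + 1, hpi, hpj, ?_, by lia⟩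
      rw [CoxeterSystem.alternatingWord_succ, cs.wordProd_concat, ← mul_assoc, ← hw,
        cs.simple_mul_simple_cancel_right]
    · exact ⟨w, 0, hi, hj, by simp [alternatingWord], by lia⟩

theorem isReduced_of_length_mul_wordProd {p : W} {ω : List B}
    (h : cs.length (p * cs.wordProd ω) = cs.length p + ω.length) : cs.IsReduced ω := by
  have h1 := cs.length_mul_le p (cs.wordProd ω)
  have h2 := cs.length_wordProd_le ω
  unfold CoxeterSystem.IsReduced
  lia

theorem length_alternatingWord_le {p : W} {i j : B} {k : ℕ}
    (h : cs.length (p * cs.wordProd (alternatingWord i j k)) = cs.length p + k)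
    (hM : M i j ≠ 0) : k ≤ M i j := by
  by_contra! hk
  exact cs.not_isReduced_alternatingWord i j hM hk
    (isReduced_of_length_mul_wordProd cs (by simpa using h))

/-- The braid relation rewrites the word, which ends in `j`, into one that ends in `i`. -/
theorem isRightDescent_mul_braidWord {p : W} {i j : B}
    (h : cs.length (p * cs.wordProd (braidWord M i j)) = cs.length p + M i j)
    (hM : M i j ≠ 0) : cs.IsRightDescent (p * cs.wordProd (braidWord M i j)) i := by
  obtain ⟨n, hn⟩ := Nat.exists_eq_succ_of_ne_zero hM
  have hle := cs.length_mul_le p (cs.wordProd (alternatingWord i j n))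
  have hle' := cs.length_wordProd_le (alternatingWord i j n)
  rw [CoxeterSystem.length_alternatingWord] at hle'
  rw [CoxeterSystem.IsRightDescent, h, cs.wordProd_braidWord_eq, braidWord, M.symmetric j i, hn,
    CoxeterSystem.alternatingWord_succ, cs.wordProd_concat, ← mul_assoc,
    cs.simple_mul_simple_cancel_right]
  lia

/-- The simple root at `i` is mapped to a nonnegative vector by an element without right descent
at `i`. -/
theorem geomRep_nonneg_of_not_isRightDescent (w : W) (i : B) (hi : ¬ cs.IsRightDescent w i) :
    0 ≤ geomRep cs w (Finsupp.single i 1) := by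
  induction h : cs.length w using Nat.strong_induction_on generalizing w i with
  | _ n ih =>
    by_cases hw : w = 1
    · subst hw
      simp
    obtain ⟨j, hj⟩ := cs.exists_rightDescent_of_ne_one hw
    have hij : i ≠ j := by rintro rfl; exact hi hj
    obtain ⟨p, k, hpi, hpj, rfl, hk⟩ := exists_eq_mul_alternatingWord cs w i j hi
    -- This makes `p` strictly shorter than `w`, so induction applies to both simple roots at `p`.
    have hk0 : k ≠ 0 := by
      rintro rfl
      simp only [alternatingWord, cs.wordProd_nil, mul_one] at hj
      exact hpj hj
    refine geomRep_mul_alternatingWord_nonneg cs hij (ih _ (by lia) p i hpi rfl)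
      (ih _ (by lia) p j hpj rfl) fun hM ↦ ?_
    refine lt_of_le_of_ne (length_alternatingWord_le cs hk hM) ?_
    rintro rfl
    exact hi (isRightDescent_mul_braidWord cs hk hM)

theorem not_isRightDescent_of_geomRep_nonneg {w : W} {i : B}
    (h : 0 ≤ geomRep cs w (Finsupp.single i 1)) : ¬ cs.IsRightDescent w i := by
  intro hi
  have h' := geomRep_nonneg_of_not_isRightDescent cs _ i
    (cs.isRightDescent_iff_not_isRightDescent_mul.1 hi)
  rw [geomRep_mul_simple_self, Left.nonneg_neg_iff] at h'
  have h0 := (geomRep cs w).map_eq_zero_iff.1 (le_antisymm h' h)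
  exact one_ne_zero (Finsupp.single_eq_zero.1 h0)

/-- Minimal representatives of cosets of rank two parabolic subgroups: lengths add. -/
theorem length_mul_alternatingWord {p : W} {i j : B} (hij : i ≠ j)
    (hi : ¬ cs.IsRightDescent p i) (hj : ¬ cs.IsRightDescent p j) {k : ℕ}
    (hk : M i j ≠ 0 → k ≤ M i j) :
    cs.length (p * cs.wordProd (alternatingWord i j k)) = cs.length p + k := by
  induction k generalizing i j with
  | zero => simp [alternatingWord]
  | succ k ih =>
    have hs := M.symmetric j i
    -- The prefix of length `k < m` keeps the root at `j` nonnegative, so appending `j` increases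
    -- the length.
    have hdesc : ¬ cs.IsRightDescent (p * cs.wordProd (alternatingWord j i k)) j :=
      not_isRightDescent_of_geomRep_nonneg cs <|
        geomRep_mul_alternatingWord_nonneg cs hij.symm
          (geomRep_nonneg_of_not_isRightDescent cs p j hj)
          (geomRep_nonneg_of_not_isRightDescent cs p i hi) (by lia)
    rw [CoxeterSystem.alternatingWord_succ, cs.wordProd_concat, ← mul_assoc,
      cs.not_isRightDescent_iff.1 hdesc, ih hij.symm hj hi (by lia)]
    lia

/-- An element with two distinct right descents `i` and `j` ends with the longest element of the
rank two parabolic subgroup, which is finite. -/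
theorem exists_eq_mul_braidWord {w : W} {i j : B} (hij : i ≠ j)
    (hi : cs.IsRightDescent w i) (hj : cs.IsRightDescent w j) :
    M i j ≠ 0 ∧ ∃ p : W, w = p * cs.wordProd (braidWord M i j) ∧
      cs.length w = cs.length p + M i j := by
  obtain ⟨p, k, hpj, hpi, hw, hk⟩ := exists_eq_mul_alternatingWord cs (w * cs.simple j) j i
    (cs.isRightDescent_iff_not_isRightDescent_mul.1 hj)
  have hw' : w = p * cs.wordProd (alternatingWord i j (k + 1)) := by
    rw [CoxeterSystem.alternatingWord_succ, cs.wordProd_concat, ← mul_assoc, ← hw,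
      cs.simple_mul_simple_cancel_right]
  have hlen : cs.length w = cs.length p + (k + 1) := by
    have := cs.isRightDescent_iff.1 hj
    lia
  -- A shorter alternating word would keep the root at `i` nonnegative, against the descent at `i`.
  have key : ¬ (M i j ≠ 0 → k + 1 < M i j) := fun hlt ↦
    not_isRightDescent_of_geomRep_nonneg cs (geomRep_mul_alternatingWord_nonneg cs hij
      (geomRep_nonneg_of_not_isRightDescent cs p i hpi)
      (geomRep_nonneg_of_not_isRightDescent cs p j hpj) hlt) (hw' ▸ hi)
  push Not at key
  have hle := length_alternatingWord_le cs (hw' ▸ hlen) key.1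
  have heq : k + 1 = M i j := le_antisymm hle key.2
  exact ⟨key.1, p, by rw [hw', heq], by rw [hlen, heq]⟩

theorem isReduced_braidWord (i j : B) : cs.IsReduced (braidWord M i j) := by
  rcases eq_or_ne i j with rfl | hij
  · simp [CoxeterSystem.IsReduced, braidWord, alternatingWord]
  · have := length_mul_alternatingWord cs (p := 1) hij (cs.not_isRightDescent_one i)
      (cs.not_isRightDescent_one j) (k := M i j) (by simp)
    simpa [CoxeterSystem.IsReduced] using this

end Descents

/-! ### The weak order in terms of lengths -/

section WeakOrder

variable {B W : Type*} [Group W] {M : CoxeterMatrix B} (cs : CoxeterSystem M W)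

theorem isReduced_append {ω ω' : List B} (h : cs.IsReduced ω) (h' : cs.IsReduced ω')
    (hl : cs.length (cs.wordProd ω * cs.wordProd ω') =
      cs.length (cs.wordProd ω) + cs.length (cs.wordProd ω')) : cs.IsReduced (ω ++ ω') := by
  unfold CoxeterSystem.IsReduced at *
  rw [cs.wordProd_append, hl, h, h', List.length_append]

theorem length_mul_of_isReduced_append {ω ω' : List B} (h : cs.IsReduced (ω ++ ω')) :
    cs.length (cs.wordProd ω * cs.wordProd ω') =
      cs.length (cs.wordProd ω) + cs.length (cs.wordProd ω') := by
  have h1 := h.take ω.length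
  have h2 := h.drop ω.length
  rw [List.take_left] at h1
  rw [List.drop_left] at h2
  rw [← cs.wordProd_append, h, h1, h2, List.length_append]

theorem weakLE_iff_exists {u w : W} :
    WeakLE cs u w ↔ ∃ v, w = u * v ∧ cs.length w = cs.length u + cs.length v := by
  constructor
  · rintro ⟨ω, _, ⟨_, rfl⟩, ⟨h, rfl⟩, ν, rfl⟩
    exact ⟨cs.wordProd ν, cs.wordProd_append _ _, by
      rw [cs.wordProd_append, length_mul_of_isReduced_append cs h]⟩
  · rintro ⟨v, rfl, h⟩
    obtain ⟨ω, hω, rfl⟩ := cs.exists_isReduced u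
    obtain ⟨ν, hν, rfl⟩ := cs.exists_isReduced v
    exact ⟨ω, ω ++ ν, ⟨hω, rfl⟩, ⟨isReduced_append cs hω hν h, cs.wordProd_append _ _⟩, ν, rfl⟩

theorem isReducedSuffix_iff_exists {u w : W} :
    IsReducedSuffix cs u w ↔ ∃ v, w = v * u ∧ cs.length w = cs.length v + cs.length u := by
  constructor
  · rintro ⟨ω, _, ⟨_, rfl⟩, ⟨h, rfl⟩, ν, rfl⟩
    exact ⟨cs.wordProd ν, cs.wordProd_append _ _, by
      rw [cs.wordProd_append, length_mul_of_isReduced_append cs h]⟩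
  · rintro ⟨v, rfl, h⟩
    obtain ⟨ω, hω, rfl⟩ := cs.exists_isReduced u
    obtain ⟨ν, hν, rfl⟩ := cs.exists_isReduced v
    exact ⟨ω, ν ++ ω, ⟨hω, rfl⟩, ⟨isReduced_append cs hν hω h, cs.wordProd_append _ _⟩, ν, rfl⟩

theorem weakLE_iff {u w : W} :
    WeakLE cs u w ↔ cs.length w = cs.length u + cs.length (u⁻¹ * w) := by
  rw [weakLE_iff_exists]
  constructor
  · rintro ⟨v, rfl, h⟩
    rwa [inv_mul_cancel_left]
  · exact fun h ↦ ⟨u⁻¹ * w, (mul_inv_cancel_left u w).symm, h⟩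

theorem WeakLE.length_le {cs : CoxeterSystem M W} {u w : W} (h : WeakLE cs u w) :
    cs.length u ≤ cs.length w := by
  rw [weakLE_iff] at h
  lia

theorem weakLE_refl (w : W) : WeakLE cs w w := by simp [weakLE_iff]

theorem one_weakLE (w : W) : WeakLE cs 1 w := by simp [weakLE_iff]

theorem WeakLE.trans {cs : CoxeterSystem M W} {u v w : W} (h : WeakLE cs u v)
    (h' : WeakLE cs v w) : WeakLE cs u w := by
  obtain ⟨x, rfl, hx⟩ := (weakLE_iff_exists cs).1 h
  obtain ⟨y, rfl, hy⟩ := (weakLE_iff_exists cs).1 h'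
  refine (weakLE_iff_exists cs).2 ⟨x * y, mul_assoc _ _ _, ?_⟩
  have h1 := cs.length_mul_le x y
  have h2 := cs.length_mul_le u (x * y)
  rw [← mul_assoc] at h2
  lia

theorem WeakLE.antisymm {cs : CoxeterSystem M W} {u w : W} (h : WeakLE cs u w)
    (h' : WeakLE cs w u) : u = w := by
  have hl := le_antisymm h.length_le h'.length_le
  rw [weakLE_iff] at h
  have : cs.length (u⁻¹ * w) = 0 := by lia
  exact (inv_mul_eq_one.1 (cs.length_eq_zero_iff.1 this))

/-- Left multiplication by `u` is monotone on elements where lengths add. -/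
theorem weakLE_mul_left_iff {u x y : W} (hx : cs.length (u * x) = cs.length u + cs.length x)
    (hy : cs.length (u * y) = cs.length u + cs.length y) :
    WeakLE cs (u * x) (u * y) ↔ WeakLE cs x y := by
  rw [weakLE_iff, weakLE_iff, mul_inv_rev, mul_assoc, inv_mul_cancel_left]
  lia

theorem length_mul_of_weakLE {u x y : W} (hxy : WeakLE cs x y)
    (hy : cs.length (u * y) = cs.length u + cs.length y) :
    cs.length (u * x) = cs.length u + cs.length x := by
  obtain ⟨z, rfl, hz⟩ := (weakLE_iff_exists cs).1 hxy
  have h1 := cs.length_mul_le u x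
  have h2 := cs.length_mul_le (u * x) z
  rw [mul_assoc] at h2
  lia

theorem IsWeakJoin.unique {cs : CoxeterSystem M W} {u v w w' : W} (h : IsWeakJoin cs u v w)
    (h' : IsWeakJoin cs u v w') : w = w' :=
  (h.2.2 w' h'.1 h'.2.1).antisymm (h'.2.2 w h.1 h.2.1)

theorem weakLE_mul_simple_of_not_isRightDescent {x : W} {i : B} (h : ¬ cs.IsRightDescent x i) :
    WeakLE cs x (x * cs.simple i) :=
  (weakLE_iff_exists cs).2 ⟨cs.simple i, rfl, by
    rw [cs.not_isRightDescent_iff.1 h, cs.length_simple]⟩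

/-- If `x < y`, then `x < x s ≤ y` for some generator `s`. -/
theorem WeakLE.exists_mul_simple_weakLE {cs : CoxeterSystem M W} {x y : W} (h : WeakLE cs x y)
    (hne : x ≠ y) : ∃ i, ¬ cs.IsRightDescent x i ∧ WeakLE cs (x * cs.simple i) y := by
  obtain ⟨z, rfl, hz⟩ := (weakLE_iff_exists cs).1 h
  have hz1 : z ≠ 1 := by rintro rfl; simp at hne
  obtain ⟨i, hi⟩ := cs.exists_leftDescent_of_ne_one hz1
  rw [cs.isLeftDescent_iff] at hi
  have h1 := cs.length_mul_le (x * cs.simple i) (cs.simple i * z)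
  have h2 := cs.length_mul_le x (cs.simple i)
  rw [mul_assoc, cs.simple_mul_simple_cancel_left] at h1
  rw [cs.length_simple] at h2
  refine ⟨i, cs.not_isRightDescent_iff.2 (by lia), (weakLE_iff_exists cs).2
    ⟨cs.simple i * z, by rw [mul_assoc, cs.simple_mul_simple_cancel_left], by lia⟩⟩

/-- If `x < x s ≤ y`, then `s` is a left descent of `x⁻¹ y`. -/
theorem isLeftDescent_of_mul_simple_weakLE {x y : W} {i : B}
    (hi : ¬ cs.IsRightDescent x i) (h : WeakLE cs (x * cs.simple i) y) :
    cs.IsLeftDescent (x⁻¹ * y) i := by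
  have h' := (weakLE_mul_simple_of_not_isRightDescent cs hi).trans h
  rw [cs.not_isRightDescent_iff] at hi
  rw [weakLE_iff] at h h'
  rw [mul_inv_rev, cs.inv_simple, mul_assoc] at h
  rw [cs.isLeftDescent_iff]
  lia

end WeakOrder

/-! ### Joins below a common bound -/

section Head

open CoxeterSystem (alternatingWord braidWord)

variable {B W : Type*} [Group W] {M : CoxeterMatrix B} (cs : CoxeterSystem M W)

theorem reverse_alternatingWord (i j : B) (k : ℕ) :
    (alternatingWord i j k).reverse =
      if Even k then alternatingWord j i k else alternatingWord i j k := by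
  induction k generalizing i j with
  | zero => simp [alternatingWord]
  | succ k ih =>
    rw [CoxeterSystem.alternatingWord_succ, List.concat_eq_append, List.reverse_append, ih]
    by_cases hk : Even k
    · have h := CoxeterSystem.alternatingWord_succ' i j k
      rw [CoxeterSystem.alternatingWord_succ, List.concat_eq_append, if_pos hk] at h
      simp [hk, Nat.even_add_one, h]
    · simp [hk, Nat.even_add_one, CoxeterSystem.alternatingWord_succ']

theorem wordProd_braidWord_inv (i j : B) :
    (cs.wordProd (braidWord M i j))⁻¹ = cs.wordProd (braidWord M i j) := by
  rw [← cs.wordProd_reverse, reverse_alternatingWord]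
  split_ifs
  · rw [cs.wordProd_braidWord_eq, braidWord, M.symmetric j i]
  · rfl

/-- An element with two distinct left descents `i` and `j` starts with the longest element of the
rank two parabolic subgroup, which is finite. -/
theorem braidWord_weakLE {w : W} {i j : B} (hij : i ≠ j)
    (hi : cs.IsLeftDescent w i) (hj : cs.IsLeftDescent w j) :
    M i j ≠ 0 ∧ WeakLE cs (cs.wordProd (braidWord M i j)) w := by
  obtain ⟨hM, p, hp, hl⟩ := exists_eq_mul_braidWord cs hij (cs.isRightDescent_inv_iff.2 hi)
    (cs.isRightDescent_inv_iff.2 hj)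
  refine ⟨hM, (weakLE_iff_exists cs).2 ⟨p⁻¹, ?_, ?_⟩⟩
  · rw [← inv_inj, hp, mul_inv_rev, inv_inv, wordProd_braidWord_inv]
  · rw [cs.length_inv] at hl
    rw [cs.length_inv, isReduced_braidWord cs i j, CoxeterSystem.length_alternatingWord, hl]
    lia

theorem simple_weakLE_iff {w : W} {i : B} : WeakLE cs (cs.simple i) w ↔ cs.IsLeftDescent w i := by
  rw [weakLE_iff, cs.isLeftDescent_iff, cs.length_simple, cs.inv_simple]
  lia

theorem isLeftDescent_braidWord {i j : B} (hM : M i j ≠ 0) :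
    cs.IsLeftDescent (cs.wordProd (braidWord M i j)) i := by
  rw [← cs.isRightDescent_inv_iff, wordProd_braidWord_inv]
  have := isRightDescent_mul_braidWord cs (p := 1) (i := i) (j := j)
    (by simpa [CoxeterSystem.IsReduced] using isReduced_braidWord cs i j) hM
  simpa using this

theorem isLeftDescent_braidWord' {i j : B} (hM : M i j ≠ 0) :
    cs.IsLeftDescent (cs.wordProd (braidWord M i j)) j := by
  rw [cs.wordProd_braidWord_eq]
  exact isLeftDescent_braidWord cs (M.symmetric i j ▸ hM)

/-- The prefixes `x` of `w` for which the lengths add in the product `u x`. -/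
def IsAdmissiblePrefix (u w x : W) : Prop :=
  WeakLE cs x w ∧ cs.length (u * x) = cs.length u + cs.length x

/-- Two admissible prefixes covering a common one are bounded by an admissible prefix. -/
theorem exists_isAdmissiblePrefix_of_covers {u w x : W} {i j : B} (hij : i ≠ j)
    (hi : ¬ cs.IsRightDescent x i) (hj : ¬ cs.IsRightDescent x j)
    (hxi : IsAdmissiblePrefix cs u w (x * cs.simple i))
    (hxj : IsAdmissiblePrefix cs u w (x * cs.simple j)) :
    ∃ z, IsAdmissiblePrefix cs u w z ∧ WeakLE cs (x * cs.simple i) z ∧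
      WeakLE cs (x * cs.simple j) z := by
  have hx := length_mul_of_weakLE cs (weakLE_mul_simple_of_not_isRightDescent cs hi) hxi.2
  have hxw := (weakLE_mul_simple_of_not_isRightDescent cs hi).trans hxi.1
  obtain ⟨hM, hd⟩ := braidWord_weakLE cs hij
    (isLeftDescent_of_mul_simple_weakLE cs hi hxi.1)
    (isLeftDescent_of_mul_simple_weakLE cs hj hxj.1)
  set d := cs.wordProd (braidWord M i j) with hd_def
  have hld : cs.length d = M i j := by
    rw [hd_def, isReduced_braidWord cs i j, CoxeterSystem.length_alternatingWord]
  -- Since lengths add for `u` with both `x` and `x s_k`, ascents of `x` become ascents of `u x`;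
  -- hence lengths also add in `u x d`.
  have hux : ∀ k, ¬ cs.IsRightDescent x k → IsAdmissiblePrefix cs u w (x * cs.simple k) →
      ¬ cs.IsRightDescent (u * x) k := by
    intro k hk hxk
    rw [cs.not_isRightDescent_iff] at hk ⊢
    rw [mul_assoc, hxk.2, hk, hx]
    lia
  have hxd : cs.length (x * d) = cs.length x + cs.length d := by
    rw [hld]
    exact length_mul_alternatingWord cs hij hi hj (by simp)
  have huxd : cs.length (u * x * d) = cs.length (u * x) + M i j :=
    length_mul_alternatingWord cs hij (hux i hi hxi) (hux j hj hxj) (by simp)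
  have hcover : ∀ k, ¬ cs.IsRightDescent x k → cs.IsLeftDescent d k →
      WeakLE cs (x * cs.simple k) (x * d) := by
    intro k hk hdk
    refine (weakLE_mul_left_iff cs ?_ hxd).2 ((simple_weakLE_iff cs).2 hdk)
    rw [cs.not_isRightDescent_iff.1 hk, cs.length_simple]
  refine ⟨x * d, ⟨?_, ?_⟩, hcover i hi (isLeftDescent_braidWord cs hM),
    hcover j hj (isLeftDescent_braidWord' cs hM)⟩
  · rw [weakLE_iff] at hd hxw ⊢
    rw [mul_inv_rev, mul_assoc]
    lia
  · rw [← mul_assoc]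
    lia

/-- There is a greatest admissible prefix above every admissible prefix. -/
theorem exists_greatest_isAdmissiblePrefix_above (u w x : W) (hx : IsAdmissiblePrefix cs u w x) :
    ∃ m, IsAdmissiblePrefix cs u w m ∧ WeakLE cs x m ∧
      ∀ y, IsAdmissiblePrefix cs u w y → WeakLE cs x y → WeakLE cs y m := by
  induction h : cs.length w - cs.length x using Nat.strong_induction_on generalizing x with
  | _ n ih =>
    by_cases hex : ∃ i, ¬ cs.IsRightDescent x i ∧ IsAdmissiblePrefix cs u w (x * cs.simple i)
    · have hstep : ∀ i z, ¬ cs.IsRightDescent x i → IsAdmissiblePrefix cs u w z →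
          WeakLE cs (x * cs.simple i) z → cs.length w - cs.length z < n := by
        intro i z hi hz hiz
        have h1 := hz.1.length_le
        have h2 := hiz.length_le
        have h3 := cs.not_isRightDescent_iff.1 hi
        lia
      obtain ⟨i, hi, hxi⟩ := hex
      obtain ⟨m, hm, him, hmax⟩ := ih _ (hstep i _ hi hxi (weakLE_refl cs _)) _ hxi rfl
      refine ⟨m, hm, (weakLE_mul_simple_of_not_isRightDescent cs hi).trans him, fun y hy hxy ↦ ?_⟩
      by_cases hxy' : x = y
      · subst hxy'
        exact (weakLE_mul_simple_of_not_isRightDescent cs hi).trans him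
      obtain ⟨j, hj, hjy⟩ := hxy.exists_mul_simple_weakLE hxy'
      rcases eq_or_ne i j with rfl | hij
      · exact hmax y hy hjy
      have hxj : IsAdmissiblePrefix cs u w (x * cs.simple j) :=
        ⟨hjy.trans hy.1, length_mul_of_weakLE cs hjy hy.2⟩
      -- Diamond argument: `z` lies above both covers, so the maximum above `x s_j` is above `x s_i`
      -- as well, and hence below `m`.
      obtain ⟨z, hz, hiz, hjz⟩ := exists_isAdmissiblePrefix_of_covers cs hij hi hj hxi hxj
      obtain ⟨m', hm', hjm', hmax'⟩ := ih _ (hstep j _ hj hxj (weakLE_refl cs _)) _ hxj rfl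
      exact (hmax' y hy hjy).trans (hmax m' hm' (hiz.trans (hmax' z hz hjz)))
    · push Not at hex
      refine ⟨x, hx, weakLE_refl cs x, fun y hy hxy ↦ ?_⟩
      by_cases hxy' : x = y
      · subst hxy'
        exact weakLE_refl cs _
      obtain ⟨j, hj, hjy⟩ := hxy.exists_mul_simple_weakLE hxy'
      exact absurd ⟨hjy.trans hy.1, length_mul_of_weakLE cs hjy hy.2⟩ (hex j hj)

theorem exists_greatest_isAdmissiblePrefix (u w : W) :
    ∃ m, IsAdmissiblePrefix cs u w m ∧ ∀ y, IsAdmissiblePrefix cs u w y → WeakLE cs y m := by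
  obtain ⟨m, hm, -, h⟩ := exists_greatest_isAdmissiblePrefix_above cs u w 1
    ⟨one_weakLE cs w, by simp⟩
  exact ⟨m, hm, fun y hy ↦ h y hy (one_weakLE cs y)⟩

/-- The greatest prefix `x` of `w` for which the lengths add in the product `u x`. -/
noncomputable def greatestPrefix (u w : W) : W :=
  (exists_greatest_isAdmissiblePrefix cs u w).choose

theorem greatestPrefix_weakLE (u w : W) : WeakLE cs (greatestPrefix cs u w) w :=
  (exists_greatest_isAdmissiblePrefix cs u w).choose_spec.1.1

theorem length_mul_greatestPrefix (u w : W) :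
    cs.length (u * greatestPrefix cs u w) =
      cs.length u + cs.length (greatestPrefix cs u w) :=
  (exists_greatest_isAdmissiblePrefix cs u w).choose_spec.1.2

theorem weakLE_greatestPrefix {u w x : W} (hx : WeakLE cs x w)
    (hux : cs.length (u * x) = cs.length u + cs.length x) :
    WeakLE cs x (greatestPrefix cs u w) :=
  (exists_greatest_isAdmissiblePrefix cs u w).choose_spec.2 x ⟨hx, hux⟩

theorem greatestPrefix_eq {u w : W} (h : cs.length (u * w) = cs.length u + cs.length w) :
    greatestPrefix cs u w = w :=
  (greatestPrefix_weakLE cs u w).antisymm (weakLE_greatestPrefix cs (weakLE_refl cs w) h)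

/-- The greatest prefix for `u v` is computed by successive greatest prefixes. -/
theorem mul_greatestPrefix_mul {u v : W} (w : W)
    (h : cs.length (u * v) = cs.length u + cs.length v) :
    v * greatestPrefix cs (u * v) w = greatestPrefix cs u (v * greatestPrefix cs v w) := by
  set x := greatestPrefix cs v w with hx
  set y := greatestPrefix cs (u * v) w with hy
  have hvx : cs.length (v * x) = _ := length_mul_greatestPrefix cs v w
  have hvy' : cs.length (u * v * y) = _ := length_mul_greatestPrefix cs (u * v) w
  rw [mul_assoc] at hvy'
  have hvy : cs.length (v * y) = cs.length v + cs.length y := by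
    have h1 := cs.length_mul_le u (v * y)
    have h2 := cs.length_mul_le v y
    lia
  apply WeakLE.antisymm (cs := cs)
  -- Additivity for `u v` and `y` forces it for `v` and `y`, so `y` is a prefix of `x`.
  · refine weakLE_greatestPrefix cs ((weakLE_mul_left_iff cs hvy hvx).2 ?_) ?_
    · exact weakLE_greatestPrefix cs (greatestPrefix_weakLE cs _ _) hvy
    · lia
  -- Conversely `v` itself is admissible, so `z = v t` and `t` competes with `y`.
  · set z := greatestPrefix cs u (v * x)
    have hvz : WeakLE cs v z :=
      weakLE_greatestPrefix cs ((weakLE_iff_exists cs).2 ⟨x, rfl, hvx⟩) h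
    obtain ⟨t, ht, hlt⟩ := (weakLE_iff_exists cs).1 hvz
    have hzx : WeakLE cs z (v * x) := greatestPrefix_weakLE cs _ _
    have huz : cs.length (u * z) = _ := length_mul_greatestPrefix cs u (v * x)
    rw [ht] at hzx huz hlt ⊢
    rw [weakLE_mul_left_iff cs hlt hvx] at hzx
    refine (weakLE_mul_left_iff cs hlt hvy).2 (weakLE_greatestPrefix cs
      (hzx.trans (greatestPrefix_weakLE cs _ _)) ?_)
    rw [mul_assoc]
    lia

end Head

/-! ### Words and lengths in the Artin–Tits monoid -/

section Words

open CoxeterSystem (alternatingWord braidWord)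

variable {B : Type*} (M : CoxeterMatrix B)

@[simp]
theorem ofWord_nil : ofWord M [] = 1 := rfl

theorem ofWord_append (ω ω' : List B) : ofWord M (ω ++ ω') = ofWord M ω * ofWord M ω' := by
  simp [ofWord, FreeMonoid.ofList_append]

theorem ofWord_cons (i : B) (ω : List B) : ofWord M (i :: ω) = ofWord M [i] * ofWord M ω :=
  ofWord_append M [i] ω

theorem ofWord_surjective (g : ArtinMonoid M) : ∃ ω, ofWord M ω = g := by
  obtain ⟨a, rfl⟩ := PresentedMonoid.surjective_mk g
  exact ⟨FreeMonoid.toList a, rfl⟩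

theorem ofWord_braidWord (i j : B) : ofWord M (braidWord M i j) = ofWord M (braidWord M j i) := by
  by_cases hM : M i j = 0
  · simp [braidWord, M.symmetric j i, hM, alternatingWord]
  · exact PresentedMonoid.mk_eq_mk_of_rel ⟨i, j, hM, rfl, rfl⟩

theorem induction_ofWord {P : ArtinMonoid M → Prop} (one : P 1)
    (cons : ∀ i g, P g → P (ofWord M [i] * g)) (g : ArtinMonoid M) : P g := by
  obtain ⟨ω, rfl⟩ := ofWord_surjective M g
  induction ω with
  | nil => exact one
  | cons i ω ih => rw [ofWord_cons]; exact cons i _ ih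

/-- The word length on the Artin–Tits monoid, as a homomorphism. -/
def lengthHom : ArtinMonoid M →* Multiplicative ℕ :=
  PresentedMonoid.lift (fun _ ↦ Multiplicative.ofAdd 1) (by
    rintro _ _ ⟨s, t, -, rfl, rfl⟩
    simp [FreeMonoid.lift_ofList, M.symmetric t s])

/-- The word length on the Artin–Tits monoid. -/
def len (g : ArtinMonoid M) : ℕ := Multiplicative.toAdd (lengthHom M g)

@[simp]
theorem len_mul (f g : ArtinMonoid M) : len M (f * g) = len M f + len M g := by
  simp [len]

@[simp]
theorem len_ofWord (ω : List B) : len M (ofWord M ω) = ω.length := by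
  have : lengthHom M (ofWord M ω) =
      FreeMonoid.lift (fun _ ↦ Multiplicative.ofAdd 1) (FreeMonoid.ofList ω) := rfl
  simp [len, this, FreeMonoid.lift_ofList]

@[simp]
theorem len_one : len M 1 = 0 := len_ofWord M []

theorem len_eq_zero_iff {g : ArtinMonoid M} : len M g = 0 ↔ g = 1 := by
  constructor
  · obtain ⟨ω, rfl⟩ := ofWord_surjective M g
    rw [len_ofWord]
    intro h
    rw [List.length_eq_zero_iff.1 h, ofWord_nil]
  · rintro rfl
    exact len_one M

variable {M} {W : Type*} [Group W] (cs : CoxeterSystem M W)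

@[simp]
theorem proj_ofWord (ω : List B) : proj cs (ofWord M ω) = cs.wordProd ω := by
  have : proj cs (ofWord M ω) = FreeMonoid.lift cs.simple (FreeMonoid.ofList ω) := rfl
  rw [this, FreeMonoid.lift_ofList]
  rfl

theorem length_proj_le (g : ArtinMonoid M) : cs.length (proj cs g) ≤ len M g := by
  obtain ⟨ω, rfl⟩ := ofWord_surjective M g
  rw [proj_ofWord, len_ofWord]
  exact cs.length_wordProd_le ω

end Words

/-! ### Matsumoto's lemma and the section -/

section Section

open CoxeterSystem (alternatingWord braidWord)

variable {B W : Type*} [Group W] {M : CoxeterMatrix B} (cs : CoxeterSystem M W)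

theorem exists_ofWord_braidWord_eq_cons (i j : B) (hM : M i j ≠ 0) :
    ∃ ω, ofWord M (braidWord M i j) = ofWord M (i :: ω) ∧
      cs.wordProd (braidWord M i j) = cs.wordProd (i :: ω) ∧ ω.length + 1 = M i j := by
  obtain ⟨n, hn⟩ := Nat.exists_eq_succ_of_ne_zero hM
  by_cases h : Even n
  · refine ⟨alternatingWord j i n, ?_, ?_, by simp [hn]⟩
    · rw [ofWord_braidWord, braidWord, M.symmetric j i, hn, CoxeterSystem.alternatingWord_succ',
        if_pos h]
    · rw [cs.wordProd_braidWord_eq, braidWord, M.symmetric j i, hn,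
        CoxeterSystem.alternatingWord_succ', if_pos h]
  · refine ⟨alternatingWord i j n, ?_, ?_, by simp [hn]⟩ <;>
    rw [braidWord, hn, CoxeterSystem.alternatingWord_succ', if_neg h]

/-- **Matsumoto's lemma**: reduced words for the same element of the Coxeter group represent the
same element of the Artin–Tits monoid. -/
theorem ofWord_eq_of_isReduced {ω ω' : List B} (h : cs.IsReduced ω) (h' : cs.IsReduced ω')
    (heq : cs.wordProd ω = cs.wordProd ω') : ofWord M ω = ofWord M ω' := by
  induction hn : ω.length generalizing ω ω' with
  | zero =>
    have : ω'.length = 0 := by rw [← h', ← heq, h, hn]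
    rw [List.length_eq_zero_iff.1 hn, List.length_eq_zero_iff.1 this]
  | succ n ih =>
    have hn' : ω'.length = n + 1 := by rw [← h', ← heq, h, hn]
    obtain ⟨i, α, rfl⟩ := List.exists_cons_of_length_eq_add_one hn
    obtain ⟨j, β, rfl⟩ := List.exists_cons_of_length_eq_add_one hn'
    rw [List.length_cons, Nat.add_right_cancel_iff] at hn hn'
    have tail : ∀ {k : B} {γ δ : List B}, cs.IsReduced (k :: γ) → cs.IsReduced (k :: δ) →
        γ.length = n → cs.wordProd (k :: γ) = cs.wordProd (k :: δ) →
        ofWord M (k :: γ) = ofWord M (k :: δ) := by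
      intro k γ δ hγ hδ hl hγδ
      rw [ofWord_cons, ofWord_cons M k δ, ih (ω := γ) (ω' := δ) (hγ.drop 1) (hδ.drop 1) ?_ hl]
      rwa [cs.wordProd_cons, cs.wordProd_cons, mul_right_inj] at hγδ
    rcases eq_or_ne i j with rfl | hij
    · exact tail h h' hn heq
    have desc : ∀ {k : B} {γ : List B}, cs.IsReduced (k :: γ) →
        cs.IsLeftDescent (cs.wordProd (k :: γ)) k := by
      intro k γ hγ
      have := hγ.drop 1
      rw [List.drop_one, List.tail_cons] at this
      rw [CoxeterSystem.IsLeftDescent, hγ, cs.wordProd_cons,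
        cs.simple_mul_simple_cancel_left, this, List.length_cons]
      lia
    -- Both first letters are left descents, so some reduced word starts with the braid word. Its
    -- two forms, beginning with `i` and with `j`, link the given words; each comparison shares a
    -- first letter.
    obtain ⟨hM, hd⟩ := braidWord_weakLE cs hij (desc h) (heq ▸ desc h')
    obtain ⟨p, hp, hlp⟩ := (weakLE_iff_exists cs).1 hd
    obtain ⟨ν, hν, rfl⟩ := cs.exists_isReduced p
    rw [h, isReduced_braidWord cs, CoxeterSystem.length_alternatingWord, hν,
      List.length_cons] at hlp
    obtain ⟨γ, hγ, hγ', hlγ⟩ := exists_ofWord_braidWord_eq_cons cs i j hM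
    obtain ⟨δ, hδ, hδ', hlδ⟩ := exists_ofWord_braidWord_eq_cons cs j i (M.symmetric i j ▸ hM)
    have h1 : cs.wordProd (i :: α) = cs.wordProd (i :: (γ ++ ν)) := by
      rw [hp, hγ', ← cs.wordProd_append, List.cons_append]
    have h2 : cs.wordProd (j :: β) = cs.wordProd (j :: (δ ++ ν)) := by
      rw [← heq, hp, cs.wordProd_braidWord_eq, hδ', ← cs.wordProd_append, List.cons_append]
    have hsymm := M.symmetric i j
    have r1 : cs.IsReduced (i :: (γ ++ ν)) := by
      rw [CoxeterSystem.IsReduced, ← h1, h]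
      simp only [List.length_cons, List.length_append]
      lia
    have r2 : cs.IsReduced (j :: (δ ++ ν)) := by
      rw [CoxeterSystem.IsReduced, ← h2, h']
      simp only [List.length_cons, List.length_append]
      lia
    rw [tail h r1 hn h1, tail h' r2 hn' h2, ← List.cons_append, ofWord_append, ← hγ,
      ofWord_braidWord, hδ, ← ofWord_append, List.cons_append]

theorem lift_wordProd {ω : List B} (h : cs.IsReduced ω) :
    lift cs (cs.wordProd ω) = ofWord M ω := by
  have hs := (cs.exists_isReduced (cs.wordProd ω)).choose_spec
  exact ofWord_eq_of_isReduced cs hs.1 h hs.2.symm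

@[simp]
theorem lift_one : lift cs (1 : W) = 1 := by
  have := lift_wordProd cs (ω := []) (by simp [CoxeterSystem.IsReduced])
  simpa using this

theorem lift_simple (i : B) : lift cs (cs.simple i) = ofWord M [i] := by
  have := lift_wordProd cs (ω := [i]) (by simp [CoxeterSystem.IsReduced])
  simpa using this

@[simp]
theorem proj_lift (w : W) : proj cs (lift cs w) = w := by
  obtain ⟨ω, hω, rfl⟩ := cs.exists_isReduced w
  rw [lift_wordProd cs hω, proj_ofWord]

@[simp]
theorem len_lift (w : W) : len M (lift cs w) = cs.length w := by
  obtain ⟨ω, hω, rfl⟩ := cs.exists_isReduced w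
  rw [lift_wordProd cs hω, len_ofWord, hω]

theorem lift_mul {u v : W} (h : cs.length (u * v) = cs.length u + cs.length v) :
    lift cs (u * v) = lift cs u * lift cs v := by
  obtain ⟨ω, hω, rfl⟩ := cs.exists_isReduced u
  obtain ⟨ν, hν, rfl⟩ := cs.exists_isReduced v
  rw [lift_wordProd cs hω, lift_wordProd cs hν, ← ofWord_append, ← cs.wordProd_append,
    lift_wordProd cs (isReduced_append cs hω hν h)]

theorem lift_proj_of_length_eq {g : ArtinMonoid M} (h : cs.length (proj cs g) = len M g) :
    lift cs (proj cs g) = g := by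
  obtain ⟨ω, rfl⟩ := ofWord_surjective M g
  rw [proj_ofWord, len_ofWord] at h
  rw [proj_ofWord, lift_wordProd cs h]

/-- Factorizations of an element of the copy of `W` are length-additive factorizations in `W`. -/
theorem eq_lift_of_lift_eq_mul {w : W} {f g : ArtinMonoid M} (h : lift cs w = f * g) :
    lift cs (proj cs f) = f ∧ lift cs (proj cs g) = g ∧ w = proj cs f * proj cs g ∧
      cs.length w = cs.length (proj cs f) + cs.length (proj cs g) := by
  have h1 : w = proj cs f * proj cs g := by rw [← map_mul, ← h, proj_lift]
  have h2 := congrArg (len M) h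
  rw [len_lift, len_mul] at h2
  have h3 := cs.length_mul_le (proj cs f) (proj cs g)
  have hf := length_proj_le cs f
  have hg := length_proj_le cs g
  rw [← h1] at h3
  exact ⟨lift_proj_of_length_eq cs (by lia), lift_proj_of_length_eq cs (by lia), h1, by lia⟩

theorem lift_dvd_lift_iff {u w : W} : lift cs u ∣ lift cs w ↔ WeakLE cs u w := by
  rw [weakLE_iff_exists]
  constructor
  · rintro ⟨g, hg⟩
    obtain ⟨-, -, h1, h2⟩ := eq_lift_of_lift_eq_mul cs hg
    rw [proj_lift] at h1 h2
    exact ⟨_, h1, h2⟩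
  · rintro ⟨v, rfl, h⟩
    exact ⟨lift cs v, lift_mul cs h⟩

theorem rightDivides_lift_iff {u w : W} :
    RightDivides (lift cs u) (lift cs w) ↔ IsReducedSuffix cs u w := by
  rw [isReducedSuffix_iff_exists]
  constructor
  · rintro ⟨g, hg⟩
    obtain ⟨-, -, h1, h2⟩ := eq_lift_of_lift_eq_mul cs hg
    rw [proj_lift] at h1 h2
    exact ⟨_, h1, h2⟩
  · rintro ⟨v, rfl, h⟩
    exact ⟨lift cs v, lift_mul cs h⟩

end Section

/-! ### The head of an element of the Artin–Tits monoid -/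

section HeadAction

open CoxeterSystem (alternatingWord braidWord)

variable {B W : Type*} [Group W] {M : CoxeterMatrix B} (cs : CoxeterSystem M W)

theorem lift_mul_lift_of_weakLE {u w : W} (h : WeakLE cs u w) :
    lift cs u * lift cs (u⁻¹ * w) = lift cs w := by
  rw [weakLE_iff] at h
  rw [← lift_mul cs (by rwa [mul_inv_cancel_left]), mul_inv_cancel_left]

/-- The element `u` of `W` acts on pairs `(w, h)`, thought of as the product of `w` and `h`, by
moving into the first component as much of `u w` as `W` can hold. -/
noncomputable def headAct (u : W) : Function.End (W × ArtinMonoid M) := fun p ↦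
  (u * greatestPrefix cs u p.1, lift cs ((greatestPrefix cs u p.1)⁻¹ * p.1) * p.2)

theorem headAct_one : headAct cs 1 = 1 := by
  funext p
  have : greatestPrefix cs 1 p.1 = p.1 := greatestPrefix_eq cs (by simp)
  simp [headAct, this, Function.End.one_def]

/-- First components agree by `mul_greatestPrefix_mul`. In the second, acting by `v` and then by `u`
expels `x⁻¹ w` and then `y⁻¹ x`, whose length-additive product is what `u v` expels at once. -/
theorem headAct_mul {u v : W} (h : cs.length (u * v) = cs.length u + cs.length v) :
    headAct cs (u * v) = headAct cs u * headAct cs v := by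
  funext ⟨w, g⟩
  have hz := mul_greatestPrefix_mul cs w h
  have hy := greatestPrefix_weakLE cs (u * v) w
  have hx := greatestPrefix_weakLE cs v w
  have huvy := length_mul_greatestPrefix cs (u * v) w
  have comp : (headAct cs u * headAct cs v) (w, g) = headAct cs u (headAct cs v (w, g)) := rfl
  rw [comp]
  simp only [headAct, ← hz]
  set x := greatestPrefix cs v w
  set y := greatestPrefix cs (u * v) w
  have hyx : WeakLE cs y x := by
    refine weakLE_greatestPrefix cs hy ?_
    have h1 := cs.length_mul_le u (v * y)
    have h2 := cs.length_mul_le v y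
    rw [← mul_assoc] at h1
    lia
  rw [weakLE_iff] at hx hy hyx
  have hsplit : y⁻¹ * w = (y⁻¹ * x) * (x⁻¹ * w) := by group
  have e1 : (v * y)⁻¹ * (v * x) = y⁻¹ * x := by group
  rw [e1, hsplit, lift_mul cs (by rw [← hsplit]; lia), mul_assoc, mul_assoc]

theorem prod_map_headAct {ω : List B} (h : cs.IsReduced ω) :
    (ω.map fun i ↦ headAct cs (cs.simple i)).prod = headAct cs (cs.wordProd ω) := by
  induction ω with
  | nil => simp [headAct_one]
  | cons i ω ih =>
    have h' : cs.IsReduced ω := h.drop 1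
    rw [List.map_cons, List.prod_cons, ih h', cs.wordProd_cons, headAct_mul]
    rw [← cs.wordProd_cons, h, h', cs.length_simple, List.length_cons, add_comm]

/-- The action of the Artin–Tits monoid on pairs extending `headAct`. -/
noncomputable def headHom : ArtinMonoid M →* Function.End (W × ArtinMonoid M) :=
  PresentedMonoid.lift (fun i ↦ headAct cs (cs.simple i)) (by
    rintro _ _ ⟨s, t, -, rfl, rfl⟩
    rw [FreeMonoid.lift_ofList, FreeMonoid.lift_ofList,
      prod_map_headAct cs (isReduced_braidWord cs s t),
      prod_map_headAct cs (isReduced_braidWord cs t s), cs.wordProd_braidWord_eq])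

theorem headHom_lift (w : W) : headHom cs (lift cs w) = headAct cs w := by
  obtain ⟨ω, hω, rfl⟩ := cs.exists_isReduced w
  rw [lift_wordProd cs hω, ← prod_map_headAct cs hω]
  exact FreeMonoid.lift_ofList _ _

theorem headHom_mul_apply (f g : ArtinMonoid M) (p : W × ArtinMonoid M) :
    headHom cs (f * g) p = headHom cs f (headHom cs g p) := by
  rw [map_mul]
  rfl

theorem lift_mul_of_headAct (u : W) (p : W × ArtinMonoid M) :
    lift cs (headAct cs u p).1 * (headAct cs u p).2 = lift cs u * (lift cs p.1 * p.2) := by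
  simp only [headAct]
  rw [lift_mul cs (length_mul_greatestPrefix cs u p.1),
    ← lift_mul_lift_of_weakLE cs (greatestPrefix_weakLE cs u p.1)]
  simp only [mul_assoc]

theorem lift_mul_of_headHom (g : ArtinMonoid M) (p : W × ArtinMonoid M) :
    lift cs (headHom cs g p).1 * (headHom cs g p).2 = g * (lift cs p.1 * p.2) := by
  induction g using induction_ofWord M with
  | one => simp [Function.End.one_def]
  | cons i g ih =>
    rw [headHom_mul_apply, ← lift_simple cs, headHom_lift, lift_mul_of_headAct, ih, mul_assoc]

/-- Material passes from the first component to the second and never back. -/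
theorem headHom_fst_congr (g : ArtinMonoid M) {p q : W × ArtinMonoid M} (h : p.1 = q.1) :
    (headHom cs g p).1 = (headHom cs g q).1 := by
  induction g using induction_ofWord M with
  | one => simpa [Function.End.one_def] using h
  | cons i g ih =>
    rw [headHom_mul_apply, headHom_mul_apply, ← lift_simple cs, headHom_lift]
    simp only [headAct, ih]

/-- The head of `g`: the greatest element of `W` whose copy left-divides `g`. -/
noncomputable def head (g : ArtinMonoid M) : W := (headHom cs g (1, 1)).1

/-- The tail of `g`: the complement in `g` of the copy of its head. -/
noncomputable def tail (g : ArtinMonoid M) : ArtinMonoid M := (headHom cs g (1, 1)).2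

theorem lift_head_mul_tail (g : ArtinMonoid M) : lift cs (head cs g) * tail cs g = g := by
  have h := lift_mul_of_headHom cs g (1, 1)
  rw [lift_one, one_mul, mul_one] at h
  exact h

theorem lift_head_dvd (g : ArtinMonoid M) : lift cs (head cs g) ∣ g :=
  ⟨tail cs g, (lift_head_mul_tail cs g).symm⟩

theorem head_mul (f g : ArtinMonoid M) : head cs (f * g) = (headHom cs f (head cs g, 1)).1 := by
  rw [head, headHom_mul_apply]
  exact headHom_fst_congr cs f rfl

theorem lift_dvd_iff {w : W} {g : ArtinMonoid M} :
    lift cs w ∣ g ↔ WeakLE cs w (head cs g) := by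
  constructor
  · rintro ⟨h, rfl⟩
    rw [head_mul, headHom_lift]
    exact (weakLE_iff_exists cs).2 ⟨_, rfl, length_mul_greatestPrefix cs _ _⟩
  · exact fun h ↦ ((lift_dvd_lift_iff cs).2 h).trans (lift_head_dvd cs g)

theorem head_lift (w : W) : head cs (lift cs w) = w :=
  ((lift_dvd_lift_iff cs).1 (lift_head_dvd cs _)).antisymm ((lift_dvd_iff cs).1 dvd_rfl)

theorem head_eq_of_dvd_dvd {f g : ArtinMonoid M} (hf : lift cs (head cs g) ∣ f) (hg : f ∣ g) :
    head cs f = head cs g :=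
  ((lift_dvd_iff cs).1 ((lift_head_dvd cs f).trans hg)).antisymm ((lift_dvd_iff cs).1 hf)

/-! ### Left cancellation and absence of units. -/

/-- Acting by `s` on the head and tail of `f` gives `s x` and the expelled part times the tail. The
first determines `x`, and `x` times the second is `f`. -/
theorem ofWord_singleton_mul_left_cancel (i : B) {f g : ArtinMonoid M}
    (h : ofWord M [i] * f = ofWord M [i] * g) : f = g := by
  let cs := M.toCoxeterSystem
  have key := congrArg (fun k ↦ headHom cs k (1, 1)) h
  simp only [headHom_mul_apply, ← lift_simple cs, headHom_lift] at key
  have h1 := congrArg Prod.fst key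
  have h2 := congrArg Prod.snd key
  simp only [headAct, mul_right_inj] at h1 h2
  have hf := greatestPrefix_weakLE cs (cs.simple i) (headHom cs f (1, 1)).1
  have hg := greatestPrefix_weakLE cs (cs.simple i) (headHom cs g (1, 1)).1
  rw [← lift_head_mul_tail cs f, ← lift_head_mul_tail cs g]
  simp only [head, tail]
  rw [← lift_mul_lift_of_weakLE cs hf, ← lift_mul_lift_of_weakLE cs hg, mul_assoc, mul_assoc, h2,
    h1]

theorem mul_left_cancel_artinMonoid (f g h : ArtinMonoid M) (hfg : f * g = f * h) : g = h := by
  induction f using induction_ofWord M with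
  | one => simpa using hfg
  | cons i f ih =>
    rw [mul_assoc, mul_assoc] at hfg
    exact ih (ofWord_singleton_mul_left_cancel i hfg)

theorem eq_one_of_mul_eq_one (f g : ArtinMonoid M) (h : f * g = 1) : f = 1 ∧ g = 1 := by
  have := congrArg (len M) h
  rw [len_mul, len_one] at this
  exact ⟨(len_eq_zero_iff M).1 (by lia), (len_eq_zero_iff M).1 (by lia)⟩

/-! ### Greedy normal decompositions. -/

theorem head_ne_one {g : ArtinMonoid M} (hg : g ≠ 1) : head cs g ≠ 1 := by
  intro h
  obtain ⟨ω, rfl⟩ := ofWord_surjective M g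
  cases ω with
  | nil => exact hg rfl
  | cons i ω =>
    have : WeakLE cs (cs.simple i) (head cs (ofWord M (i :: ω))) := by
      rw [← lift_dvd_iff, lift_simple, ofWord_cons M i ω]
      exact ⟨_, rfl⟩
    have := this.length_le
    rw [h] at this
    simp at this

/-- The copies of the head of `g` and of the head of its tail form a greedy pair. -/
theorem isGreedyPair_lift_head (g : ArtinMonoid M) :
    IsGreedyPair (copy cs) (lift cs (head cs g)) (lift cs (head cs (tail cs g))) := by
  rintro _ ⟨w, rfl⟩ f h
  have hdvd : lift cs (head cs g) * lift cs (head cs (tail cs g)) ∣ g := by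
    obtain ⟨k, hk⟩ := lift_head_dvd cs (tail cs g)
    exact ⟨k, by rw [mul_assoc, ← hk, lift_head_mul_tail]⟩
  -- The product of the two heads lies between the head of `g` and `g`, so it has the same head as
  -- its first factor; prepending `f` keeps the heads equal.
  rw [mul_assoc, lift_dvd_iff, head_mul, head_eq_of_dvd_dvd cs (dvd_mul_right _ _) hdvd] at h
  rwa [lift_dvd_iff, head_mul, head_lift]

/-- Iterate head and tail, the tail being shorter. Tracking the first entry is what lets the
induction extend the chain condition. -/
theorem exists_isNormalDecomposition (g : ArtinMonoid M) :
    ∃ l, IsNormalDecomposition (copy cs) l g ∧ ∀ a ∈ l.head?, a = lift cs (head cs g) := by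
  induction h : len M g using Nat.strong_induction_on generalizing g with
  | _ n ih =>
    by_cases hg : g = 1
    · exact ⟨[], ⟨by simp [hg], by simp, List.isChain_nil⟩, by simp⟩
    have hlen := congrArg (len M) (lift_head_mul_tail cs g)
    rw [len_mul, len_lift] at hlen
    have hpos : cs.length (head cs g) ≠ 0 :=
      fun h0 ↦ head_ne_one cs hg (cs.length_eq_zero_iff.1 h0)
    obtain ⟨l, ⟨hprod, hmem, hchain⟩, hhead⟩ := ih _ (by lia) (tail cs g) rfl
    refine ⟨lift cs (head cs g) :: l, ⟨?_, ?_, ?_⟩, by simp⟩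
    · rw [List.prod_cons, hprod, lift_head_mul_tail]
    · rintro a (_ | ⟨_, ha⟩)
      · exact ⟨_, rfl⟩
      · exact hmem a ha
    · rw [List.isChain_cons]
      exact ⟨fun a ha ↦ hhead a ha ▸ isGreedyPair_lift_head cs g, hchain⟩

theorem isGarsideFamily_copy : IsGarsideFamily (copy cs) where
  left_cancel := mul_left_cancel_artinMonoid
  no_units := eq_one_of_mul_eq_one
  one_mem := ⟨1, lift_one cs⟩
  exists_normal g := (exists_isNormalDecomposition cs g).imp fun _ h ↦ h.1

/-! ### Right-lcms and joins. -/

theorem eq_of_dvd_of_dvd {f g : ArtinMonoid M} (h : f ∣ g) (h' : g ∣ f) : f = g := by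
  obtain ⟨a, rfl⟩ := h
  obtain ⟨b, hb⟩ := h'
  have := congrArg (len M) hb
  simp only [len_mul] at this
  rw [(len_eq_zero_iff M).1 (by lia : len M a = 0), mul_one]

/-- A right-lcm of elements of the copy of `W` lies in it, and comes from a join. -/
theorem IsRightLcm.isWeakJoin {u v : W} {h : ArtinMonoid M}
    (hh : IsRightLcm (lift cs u) (lift cs v) h) :
    lift cs (head cs h) = h ∧ IsWeakJoin cs u v (head cs h) := by
  obtain ⟨hu, hv, hmin⟩ := hh
  have hu' := (lift_dvd_iff cs).1 hu
  have hv' := (lift_dvd_iff cs).1 hv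
  -- The head of `h` is already a common multiple, so minimality makes `h` divide it.
  have heq : lift cs (head cs h) = h := eq_of_dvd_of_dvd (lift_head_dvd cs h)
    (hmin _ ((lift_dvd_lift_iff cs).2 hu') ((lift_dvd_lift_iff cs).2 hv'))
  refine ⟨heq, hu', hv', fun x hux hvx ↦ ?_⟩
  rw [← lift_dvd_lift_iff, heq]
  exact hmin _ ((lift_dvd_lift_iff cs).2 hux) ((lift_dvd_lift_iff cs).2 hvx)

theorem IsWeakJoin.isRightLcm {u v w : W} (h : IsWeakJoin cs u v w) :
    IsRightLcm (lift cs u) (lift cs v) (lift cs w) :=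
  ⟨(lift_dvd_lift_iff cs).2 h.1, (lift_dvd_lift_iff cs).2 h.2.1, fun _ hu hv ↦
    (lift_dvd_iff cs).2 (h.2.2 _ ((lift_dvd_iff cs).1 hu) ((lift_dvd_iff cs).1 hv))⟩

end HeadAction

end ArtinTits

theorem lemma3p1 {B : Type*} {W : Type*} [Group W] {M : CoxeterMatrix B}
    (cs : CoxeterSystem M W) :
    -- the section is well defined: any reduced word for `w` represents the lift of `w`
    (∀ ω : List B, cs.IsReduced ω →
      ArtinTits.lift cs (cs.wordProd ω) = ArtinTits.ofWord M ω) ∧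
    -- the copy of `W` is a Garside family
    ArtinTits.IsGarsideFamily (ArtinTits.copy cs) ∧
    -- divisibility in the copy of `W`
    (∀ f ∈ ArtinTits.copy cs, ∀ g ∈ ArtinTits.copy cs,
      (f ∣ g ↔ ArtinTits.WeakLE cs (ArtinTits.proj cs f) (ArtinTits.proj cs g)) ∧
      (ArtinTits.RightDivides f g ↔
        ArtinTits.IsReducedSuffix cs (ArtinTits.proj cs f) (ArtinTits.proj cs g))) ∧
    -- right-lcms and joins
    (∀ f ∈ ArtinTits.copy cs, ∀ g ∈ ArtinTits.copy cs,
      ((∃ h : ArtinTits.ArtinMonoid M, ArtinTits.IsRightLcm f g h) ↔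
        ∃ w : W, ArtinTits.IsWeakJoin cs (ArtinTits.proj cs f) (ArtinTits.proj cs g) w) ∧
      (∀ (h : ArtinTits.ArtinMonoid M) (w : W), ArtinTits.IsRightLcm f g h →
        ArtinTits.IsWeakJoin cs (ArtinTits.proj cs f) (ArtinTits.proj cs g) w →
        h ∈ ArtinTits.copy cs ∧ h = ArtinTits.lift cs w)) := by
  refine ⟨fun ω hω ↦ ArtinTits.lift_wordProd cs hω, ArtinTits.isGarsideFamily_copy cs, ?_, ?_⟩
  · rintro _ ⟨u, rfl⟩ _ ⟨v, rfl⟩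
    rw [ArtinTits.proj_lift, ArtinTits.proj_lift]
    exact ⟨ArtinTits.lift_dvd_lift_iff cs, ArtinTits.rightDivides_lift_iff cs⟩
  · rintro _ ⟨u, rfl⟩ _ ⟨v, rfl⟩
    rw [ArtinTits.proj_lift, ArtinTits.proj_lift]
    refine ⟨⟨?_, ?_⟩, ?_⟩
    · rintro ⟨h, hh⟩
      exact ⟨_, (ArtinTits.IsRightLcm.isWeakJoin cs hh).2⟩
    · rintro ⟨w, hw⟩
      exact ⟨_, ArtinTits.IsWeakJoin.isRightLcm cs hw⟩
    · intro h w hh hw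
      obtain ⟨heq, hj⟩ := ArtinTits.IsRightLcm.isWeakJoin cs hh
      rw [hw.unique hj, heq]
      exact ⟨⟨_, heq⟩, rfl⟩
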